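/- Write $\langle i,j\rangle=\sum_k i_kj_k$ for the standard scalar product of $\mathbb Z_2^n$. A $\mathbb Z_2^n$-ringed space is a Hausdorff second-countable topological space $M$ with a sheaf $\mathcal A_M$ of $\mathbb Z_2^n$-graded associative unital $\mathbb R$-algebras (restrictions being graded) that are $\mathbb Z_2^n$-commutative: $ab=(-1)^{\langle i,j\rangle}ba$ for $a$ of degree $i$ and $b$ of degree $j$. A $\mathbb Z_2^n$-supermanifold of dimension $p|\sigma$, where $\sigma=(\sigma_1,\dots,\sigma_q)$ is a list of elements of $\mathbb Z_2^n\setminus\{0\}$, is a $\mathbb Z_2^n$-ringed space $(M,\mathcal A_M)$ every point of which has an open neighbourhood $U$ such that $(U,\mathcal A_M|_U)$ is isomorphic to some superdomain $(V, C^\infty_V[[\xi^1,\dots,\xi^q]])$; here $V\subset\mathbb R^p$ is open and the $\xi^a$ are formal variables of degrees $\sigma_a$ with $\xi^a\xi^b=(-1)^{\langle\sigma_a,\sigma_b\rangle}\xi^b\xi^a$. A morphism $\Psi=(\psi,\psi^*)$ from $(M,\mathcal A_M)$ to $(N,\mathcal B_N)$ consists of a continuous map $\psi:M\to N$ and, for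 each open $V\subset N$, a graded unital $\mathbb R$-algebra morphism $\psi_V^*:\mathcal B_N(V)\to\mathcal A_M(\psi^{-1}(V))$, compatible with restrictions; it induces morphisms of stalks $\psi_m^*:\mathcal B_{\psi(m)}\to\mathcal A_m$. Let $(M,\mathcal A_M)$ and $(N,\mathcal B_N)$ be $\mathbb Z_2^n$-supermanifolds, of dimensions $p|\sigma$ and $p'|\sigma'$. For every open $U\subset M$, $f\in\mathcal A_M(U)$ and $m\in U$ there is a unique real number $\varepsilon_U(f)(m)=k$ such that $f-k$ is not invertible in any neighbourhood of $m$; let $\mathcal J_M(U)=\{f\in\mathcal A_M(U):\varepsilon_U(f)=0\}$. The base homeomorphisms $U\to V$ of all local isomorphisms of $(M,\mathcal A_M)$ with superdomains as above, form an atlas of a smooth $p$-dimensional manifold structure on $M$, for which a function on an open subset of $M$ is smooth if and only if it is locally of the form $\varepsilon(f)$ with $f$ a section of $\mathcal A_M$. Moreover: 1. For every $m\in M$ the stalk $\mathcal A_m$ has a unique maximal homogeneous ideal $\mathfrak m_m$, and $\mathfrak m_m=\{[f]_m:(\varepsilon f)(m)=0\}$. Let $\Psi=(\psi,\psi^*)$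 be any morphism from $(M,\mathcal A_M)$ to $(N,\mathcal B_N)$. Then: 2. For every open $V\subset N$, with $U=\psi^{-1}(V)$: $\varepsilon_U\circ\psi_V^*=(-\circ\psi|_U)\circ\varepsilon_V$. 3. $\Psi$ is continuous with respect to $\mathcal J$ and $\mathfrak m$, i.e. for every open $V\subset N$ and every $m\in M$: $\psi_V^*(\mathcal J_N(V))\subset\mathcal J_M(\psi^{-1}(V))$ and $\psi_m^*(\mathfrak m_{\psi(m)})\subset\mathfrak m_m$. 4. The base map $\psi:M\to N$ is smooth. -/

import Mathlib

open TopologicalSpace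
open scoped Manifold ContDiff

universe u v u' v'

namespace ZTwoN

/-! ### Degrees and the sign rule -/

/-- The grading group `ℤ₂ⁿ`. -/
abbrev Deg (n : ℕ) : Type := Fin n → ZMod 2

/-- The standard scalar product `⟨i, j⟩ = i₁ j₁ + ⋯ + iₙ jₙ` of `ℤ₂ⁿ`, as an exponent of `-1`
(only its parity matters; it is represented by `0` or `1`). -/
def pairing {n : ℕ} (i j : Deg n) : ℕ := (∑ k, i k * j k : ZMod 2).val

/-- A degree is odd if the sum of its components is `1` in `ℤ₂`. -/
def IsOdd {n : ℕ} (i : Deg n) : Prop := ∑ k, i k = 1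

/-! ### Formal power series in graded-commuting variables -/

section FormalSeries

variable {n q : ℕ}

/-- The exponents `μ` of the monomials `ξ^μ = (ξ¹)^μ₁ ⋯ (ξ^q)^μ_q` that do not vanish: an odd
variable squares to zero, so that it occurs with exponent at most `1`. -/
def Admissible (σ : Fin q → Deg n) (μ : Fin q →₀ ℕ) : Prop := ∀ a, IsOdd (σ a) → μ a ≤ 1

/-- The sign `±1` in `ξ^μ ξ^ν = ± ξ^(μ+ν)`, that is, the sign produced by moving every factor `ξ^b`
of `ξ^ν` to the left, across the factors `ξ^a` of `ξ^μ` with `b < a`, by means of the rule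
`ξ^a ξ^b = (-1)^⟨σ_a, σ_b⟩ ξ^b ξ^a`. -/
def reorderSign (σ : Fin q → Deg n) (μ ν : Fin q →₀ ℕ) : ℤ :=
  (-1) ^ (∑ a, ∑ b, if b < a then pairing (σ a) (σ b) * μ a * ν b else 0)

lemma reorderSign_add_left (σ : Fin q → Deg n) (μ μ' ν : Fin q →₀ ℕ) :
    reorderSign σ (μ + μ') ν = reorderSign σ μ ν * reorderSign σ μ' ν := by
  unfold reorderSign
  rw [← pow_add, ← Finset.sum_add_distrib]
  congr 1
  refine Finset.sum_congr rfl fun a _ => ?_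
  rw [← Finset.sum_add_distrib]
  refine Finset.sum_congr rfl fun b _ => ?_
  split_ifs
  · simp only [Finsupp.add_apply]; ring
  · rfl

lemma reorderSign_add_right (σ : Fin q → Deg n) (μ ν ν' : Fin q →₀ ℕ) :
    reorderSign σ μ (ν + ν') = reorderSign σ μ ν * reorderSign σ μ ν' := by
  unfold reorderSign
  rw [← pow_add, ← Finset.sum_add_distrib]
  congr 1
  refine Finset.sum_congr rfl fun a _ => ?_
  rw [← Finset.sum_add_distrib]
  refine Finset.sum_congr rfl fun b _ => ?_
  split_ifs
  · simp only [Finsupp.add_apply]; ring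
  · rfl

lemma reorderSign_zero_left (σ : Fin q → Deg n) (ν : Fin q →₀ ℕ) : reorderSign σ 0 ν = 1 := by
  simp [reorderSign]

lemma reorderSign_zero_right (σ : Fin q → Deg n) (μ : Fin q →₀ ℕ) : reorderSign σ μ 0 = 1 := by
  simp [reorderSign]

lemma Admissible.left {σ : Fin q → Deg n} {μ ν : Fin q →₀ ℕ} (h : Admissible σ (μ + ν)) :
    Admissible σ μ := fun a ha => le_trans (by simp) (h a ha)

lemma Admissible.right {σ : Fin q → Deg n} {μ ν : Fin q →₀ ℕ} (h : Admissible σ (μ + ν)) :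
    Admissible σ ν := fun a ha => le_trans (by simp) (h a ha)

/-- The algebra `R[[ξ¹, …, ξ^q]]_σ` of formal power series `∑_μ f_μ ξ^μ` in formal variables `ξ^a`
of degrees `σ a`, with coefficients in `R`; the monomials run through the admissible exponents. -/
@[ext]
structure FormalSeries (σ : Fin q → Deg n) (R : Type v) [CommRing R] where
  coeff : (Fin q →₀ ℕ) → R
  coeff_eq_zero : ∀ μ, ¬ Admissible σ μ → coeff μ = 0

namespace FormalSeries

variable {σ : Fin q → Deg n} {R : Type v} [CommRing R]

instance : Zero (FormalSeries σ R) := ⟨⟨fun _ => 0, fun _ _ => rfl⟩⟩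

instance : Add (FormalSeries σ R) :=
  ⟨fun f g => ⟨fun μ => f.coeff μ + g.coeff μ, fun μ h => by
    simp [f.coeff_eq_zero μ h, g.coeff_eq_zero μ h]⟩⟩

instance : Neg (FormalSeries σ R) :=
  ⟨fun f => ⟨fun μ => -f.coeff μ, fun μ h => by simp [f.coeff_eq_zero μ h]⟩⟩

open Classical in
noncomputable instance : One (FormalSeries σ R) :=
  ⟨⟨fun μ => if μ = 0 then 1 else 0, fun μ h => if_neg fun h0 => h (by
    subst h0; intro a _; simp)⟩⟩

open Classical in
/-- The product is determined by bilinearity and `ξ^μ ξ^ν = ± ξ^(μ+ν)`, the right-hand side being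
zero if `μ + ν` is not admissible. -/
noncomputable instance : Mul (FormalSeries σ R) :=
  ⟨fun f g => ⟨fun l => if Admissible σ l then
      ∑ x ∈ Finset.HasAntidiagonal.antidiagonal l, (reorderSign σ x.1 x.2 : R) * (f.coeff x.1 * g.coeff x.2)
    else 0, fun _ h => if_neg h⟩⟩

lemma zero_coeff (μ : Fin q →₀ ℕ) : (0 : FormalSeries σ R).coeff μ = 0 := rfl

lemma add_coeff (f g : FormalSeries σ R) (μ : Fin q →₀ ℕ) :
    (f + g).coeff μ = f.coeff μ + g.coeff μ := rfl

lemma neg_coeff (f : FormalSeries σ R) (μ : Fin q →₀ ℕ) : (-f).coeff μ = -f.coeff μ := rfl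

open Classical in
lemma one_coeff (μ : Fin q →₀ ℕ) :
    (1 : FormalSeries σ R).coeff μ = if μ = 0 then 1 else 0 := rfl

lemma mul_coeff (f g : FormalSeries σ R) {l : Fin q →₀ ℕ} (hl : Admissible σ l) :
    (f * g).coeff l =
      ∑ x ∈ Finset.HasAntidiagonal.antidiagonal l, (reorderSign σ x.1 x.2 : R) * (f.coeff x.1 * g.coeff x.2) :=
  if_pos hl

lemma ext_admissible {f g : FormalSeries σ R}
    (h : ∀ μ, Admissible σ μ → f.coeff μ = g.coeff μ) : f = g := by
  ext μ
  by_cases hμ : Admissible σ μ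
  · exact h μ hμ
  · rw [f.coeff_eq_zero μ hμ, g.coeff_eq_zero μ hμ]

protected lemma mul_assoc' (f g h : FormalSeries σ R) : f * g * h = f * (g * h) := by
  refine ext_admissible fun l hl => ?_
  rw [mul_coeff _ _ hl, mul_coeff _ _ hl]
  have h1 : ∀ x ∈ Finset.HasAntidiagonal.antidiagonal l,
      (reorderSign σ x.1 x.2 : R) * ((f * g).coeff x.1 * h.coeff x.2) =
        ∑ y ∈ Finset.HasAntidiagonal.antidiagonal x.1, (reorderSign σ x.1 x.2 : R) *
          ((reorderSign σ y.1 y.2 : R) * (f.coeff y.1 * g.coeff y.2) * h.coeff x.2) := by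
    intro x hx
    rw [Finset.HasAntidiagonal.mem_antidiagonal] at hx
    rw [mul_coeff _ _ (Admissible.left (hx ▸ hl)), Finset.sum_mul, Finset.mul_sum]
  have h2 : ∀ x ∈ Finset.HasAntidiagonal.antidiagonal l,
      (reorderSign σ x.1 x.2 : R) * (f.coeff x.1 * (g * h).coeff x.2) =
        ∑ y ∈ Finset.HasAntidiagonal.antidiagonal x.2, (reorderSign σ x.1 x.2 : R) *
          (f.coeff x.1 * ((reorderSign σ y.1 y.2 : R) * (g.coeff y.1 * h.coeff y.2))) := by
    intro x hx
    rw [Finset.HasAntidiagonal.mem_antidiagonal] at hx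
    rw [mul_coeff _ _ (Admissible.right (hx ▸ hl)), Finset.mul_sum, Finset.mul_sum]
  rw [Finset.sum_congr rfl h1, Finset.sum_congr rfl h2, Finset.sum_sigma', Finset.sum_sigma']
  refine Finset.sum_nbij' (fun ⟨⟨_i, j⟩, ⟨k, l⟩⟩ => ⟨(k, l + j), (l, j)⟩)
    (fun ⟨⟨i, _j⟩, ⟨k, l⟩⟩ => ⟨(i + k, l), (i, k)⟩) ?_ ?_ ?_ ?_ ?_
  · rintro ⟨⟨i, j⟩, ⟨k, m⟩⟩ hx
    simp only [Finset.mem_sigma, Finset.HasAntidiagonal.mem_antidiagonal] at hx ⊢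
    rw [← hx.1, ← hx.2]; simp [add_assoc]
  · rintro ⟨⟨i, j⟩, ⟨k, m⟩⟩ hx
    simp only [Finset.mem_sigma, Finset.HasAntidiagonal.mem_antidiagonal] at hx ⊢
    rw [← hx.1, ← hx.2]; simp [add_assoc]
  · rintro ⟨⟨i, j⟩, ⟨k, m⟩⟩ hx
    simp only [Finset.mem_sigma, Finset.HasAntidiagonal.mem_antidiagonal] at hx
    obtain ⟨_, rfl⟩ := hx
    rfl
  · rintro ⟨⟨i, j⟩, ⟨k, m⟩⟩ hx
    simp only [Finset.mem_sigma, Finset.HasAntidiagonal.mem_antidiagonal] at hx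
    obtain ⟨_, rfl⟩ := hx
    rfl
  · rintro ⟨⟨i, j⟩, ⟨k, m⟩⟩ hx
    simp only [Finset.mem_sigma, Finset.HasAntidiagonal.mem_antidiagonal] at hx
    obtain ⟨_, rfl⟩ := hx
    simp only [reorderSign_add_left, reorderSign_add_right, Int.cast_mul]
    ring

protected lemma one_mul' (f : FormalSeries σ R) : 1 * f = f := by
  classical
  refine ext_admissible fun l hl => ?_
  rw [mul_coeff _ _ hl, Finset.sum_eq_single (0, l)]
  · simp [one_coeff, reorderSign_zero_left]
  · rintro ⟨i, j⟩ hx hne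
    rw [Finset.HasAntidiagonal.mem_antidiagonal] at hx
    have : i ≠ 0 := by
      rintro rfl
      exact hne (by simpa using hx)
    simp [one_coeff, this]
  · intro hx
    simp at hx

protected lemma mul_one' (f : FormalSeries σ R) : f * 1 = f := by
  classical
  refine ext_admissible fun l hl => ?_
  rw [mul_coeff _ _ hl, Finset.sum_eq_single (l, 0)]
  · simp [one_coeff, reorderSign_zero_right]
  · rintro ⟨i, j⟩ hx hne
    rw [Finset.HasAntidiagonal.mem_antidiagonal] at hx
    have : j ≠ 0 := by
      rintro rfl
      exact hne (by simpa using hx)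
    simp [one_coeff, this]
  · intro hx
    simp at hx

noncomputable instance : Ring (FormalSeries σ R) where
  add_assoc f g h := by ext μ; simp [add_coeff, add_assoc]
  zero_add f := by ext μ; simp [add_coeff, zero_coeff]
  add_zero f := by ext μ; simp [add_coeff, zero_coeff]
  add_comm f g := by ext μ; simp [add_coeff, add_comm]
  neg_add_cancel f := by ext μ; simp [add_coeff, neg_coeff, zero_coeff]
  nsmul := nsmulRec
  zsmul := zsmulRec
  mul_assoc := FormalSeries.mul_assoc'
  one_mul := FormalSeries.one_mul'
  mul_one := FormalSeries.mul_one'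
  zero_mul f := ext_admissible fun l hl => by simp [mul_coeff _ _ hl, zero_coeff]
  mul_zero f := ext_admissible fun l hl => by simp [mul_coeff _ _ hl, zero_coeff]
  left_distrib f g h := ext_admissible fun l hl => by
    simp [mul_coeff _ _ hl, add_coeff, mul_add, Finset.sum_add_distrib]
  right_distrib f g h := ext_admissible fun l hl => by
    simp [mul_coeff _ _ hl, add_coeff, mul_add, add_mul, Finset.sum_add_distrib]

open Classical in
/-- The constant series, as a ring homomorphism `R → R[[ξ]]`. -/
noncomputable def const (σ : Fin q → Deg n) (R : Type v) [CommRing R] : R →+* FormalSeries σ R where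
  toFun r := ⟨fun μ => if μ = 0 then r else 0, fun μ h => if_neg fun h0 => h (by
    subst h0; intro a _; simp)⟩
  map_one' := rfl
  map_zero' := by ext μ; simp [zero_coeff]
  map_add' r s := by
    ext μ
    simp only [add_coeff]
    split_ifs <;> simp
  map_mul' r s := ext_admissible fun l hl => by
    rw [mul_coeff _ _ hl, Finset.sum_eq_single (0, l)]
    · simp [reorderSign_zero_left]
    · rintro ⟨i, j⟩ hx hne
      rw [Finset.HasAntidiagonal.mem_antidiagonal] at hx
      have : i ≠ 0 := by
        rintro rfl
        exact hne (by simpa using hx)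
      simp [this]
    · intro hx
      simp at hx

open Classical in
lemma const_coeff (r : R) (μ : Fin q →₀ ℕ) :
    (const σ R r).coeff μ = if μ = 0 then r else 0 := rfl

lemma const_mul_coeff (r : R) (f : FormalSeries σ R) (μ : Fin q →₀ ℕ) :
    (const σ R r * f).coeff μ = r * f.coeff μ := by
  classical
  by_cases hl : Admissible σ μ
  · rw [mul_coeff _ _ hl, Finset.sum_eq_single (0, μ)]
    · simp [const_coeff, reorderSign_zero_left]
    · rintro ⟨i, j⟩ hx hne
      rw [Finset.HasAntidiagonal.mem_antidiagonal] at hx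
      have : i ≠ 0 := by
        rintro rfl
        exact hne (by simpa using hx)
      simp [const_coeff, this]
    · intro hx
      simp at hx
  · rw [coeff_eq_zero _ _ hl, coeff_eq_zero _ _ hl, mul_zero]

lemma mul_const_coeff (r : R) (f : FormalSeries σ R) (μ : Fin q →₀ ℕ) :
    (f * const σ R r).coeff μ = f.coeff μ * r := by
  classical
  by_cases hl : Admissible σ μ
  · rw [mul_coeff _ _ hl, Finset.sum_eq_single (μ, 0)]
    · simp [const_coeff, reorderSign_zero_right]
    · rintro ⟨i, j⟩ hx hne
      rw [Finset.HasAntidiagonal.mem_antidiagonal] at hx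
      have : j ≠ 0 := by
        rintro rfl
        exact hne (by simpa using hx)
      simp [const_coeff, this]
    · intro hx
      simp at hx
  · rw [coeff_eq_zero _ _ hl, coeff_eq_zero _ _ hl, zero_mul]

noncomputable instance [Algebra ℝ R] : Algebra ℝ (FormalSeries σ R) :=
  ((const σ R).comp (algebraMap ℝ R)).toAlgebra' fun c f => by
    ext μ
    simp only [RingHom.comp_apply, const_mul_coeff, mul_const_coeff, mul_comm]

/-- The series all of whose terms have degree `i`, the degree of `ξ^μ` being `∑ a, μ_a σ_a`. -/
def HasDeg (i : Deg n) (f : FormalSeries σ R) : Prop :=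
  ∀ μ, f.coeff μ ≠ 0 → ∑ a, μ a • σ a = i

/-- Application of a ring homomorphism to all coefficients. -/
def map {S : Type v'} [CommRing S] (φ : R →+* S) (f : FormalSeries σ R) : FormalSeries σ S :=
  ⟨fun μ => φ (f.coeff μ), fun μ h => by rw [f.coeff_eq_zero μ h, map_zero]⟩

end FormalSeries

end FormalSeries

/-! ### `ℤ₂ⁿ`-ringed spaces -/

/-- A `ℤ₂ⁿ`-ringed space: a Hausdorff second-countable topological space with a sheaf of
`ℤ₂ⁿ`-commutative associative unital `ℝ`-algebras (graded by `ℤ₂ⁿ`, with grading respected by the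
restrictions, and satisfying `ab = (-1)^⟨i, j⟩ ba` for `a` of degree `i` and `b` of degree `j`). -/
structure RingedSpace (n : ℕ) where
  carrier : Type u
  [topologicalSpace : TopologicalSpace carrier]
  [t2Space : T2Space carrier]
  [secondCountable : SecondCountableTopology carrier]
  /-- The algebra of sections over an open set. -/
  Sec : Opens carrier → Type v
  [ring : ∀ U, Ring (Sec U)]
  [algebra : ∀ U, Algebra ℝ (Sec U)]
  /-- The homogeneous components. -/
  deg : ∀ U, Deg n → Submodule ℝ (Sec U)
  gradedMonoid : ∀ U, SetLike.GradedMonoid (deg U)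
  isInternal : ∀ U, DirectSum.IsInternal (deg U)
  graded_comm : ∀ U i j, ∀ a ∈ deg U i, ∀ b ∈ deg U j, a * b = (-1) ^ pairing i j * (b * a)
  /-- The restriction maps. -/
  res : ∀ {U V : Opens carrier}, V ≤ U → (Sec U →ₐ[ℝ] Sec V)
  res_self : ∀ (U : Opens carrier) (f : Sec U), res (le_refl U) f = f
  res_res : ∀ {U V W : Opens carrier} (hVU : V ≤ U) (hWV : W ≤ V) (f : Sec U),
    res hWV (res hVU f) = res (hWV.trans hVU) f
  res_deg : ∀ {U V : Opens carrier} (h : V ≤ U) (i : Deg n), ∀ f ∈ deg U i, res h f ∈ deg V i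
  /-- The sheaf condition. -/
  existsUnique_glue : ∀ {ι : Type u} (U : ι → Opens carrier) (f : ∀ i, Sec (U i)),
    (∀ i j, res (inf_le_left : U i ⊓ U j ≤ U i) (f i) = res inf_le_right (f j)) →
    ∃! s : Sec (⨆ i, U i), ∀ i, res (le_iSup U i) s = f i

attribute [instance] RingedSpace.topologicalSpace RingedSpace.t2Space RingedSpace.secondCountable
  RingedSpace.ring RingedSpace.algebra

namespace RingedSpace

variable {n : ℕ} (X : RingedSpace.{u, v} n)

/-! #### Stalks -/

/-- The open neighbourhoods of `m`, ordered by reverse inclusion. -/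
abbrev Nhd (m : X.carrier) : Type u := {U : (Opens X.carrier)ᵒᵈ // m ∈ OrderDual.ofDual U}

/-- The open set underlying a neighbourhood. -/
abbrev Nhd.toOpens {X : RingedSpace.{u, v} n} {m : X.carrier} (U : X.Nhd m) : Opens X.carrier :=
  OrderDual.ofDual U.1

instance (m : X.carrier) : Nonempty (X.Nhd m) := ⟨⟨OrderDual.toDual ⊤, trivial⟩⟩

instance (m : X.carrier) : IsDirectedOrder (X.Nhd m) where
  directed U V := ⟨⟨OrderDual.toDual (U.toOpens ⊓ V.toOpens), ⟨U.2, V.2⟩⟩,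
    (inf_le_left : U.toOpens ⊓ V.toOpens ≤ U.toOpens),
    (inf_le_right : U.toOpens ⊓ V.toOpens ≤ V.toOpens)⟩

/-- The restriction maps between the neighbourhoods of `m`. -/
abbrev nhdRes (m : X.carrier) (U V : X.Nhd m) (h : U ≤ V) :
    X.Sec U.toOpens →ₐ[ℝ] X.Sec V.toOpens :=
  X.res (show V.toOpens ≤ U.toOpens from h)

instance (m : X.carrier) :
    DirectedSystem (fun U : X.Nhd m => X.Sec U.toOpens) (X.nhdRes m · · ·) where
  map_self U f := X.res_self U.toOpens f
  map_map _ _ _ hUV hVW f := X.res_res hUV hVW f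

/-- The stalk at `m`: the direct limit of the algebras of sections over the open neighbourhoods
of `m`. -/
abbrev Stalk (m : X.carrier) : Type (max u v) :=
  DirectLimit (fun U : X.Nhd m => X.Sec U.toOpens) (X.nhdRes m)

/-- The germ at `m` of a section. -/
noncomputable def germ {U : Opens X.carrier} (m : U) : X.Sec U →+* X.Stalk m.1 :=
  DirectLimit.Ring.of (fun U : X.Nhd m.1 => X.Sec U.toOpens) (X.nhdRes m.1)
    ⟨OrderDual.toDual U, m.2⟩

/-- A germ has degree `i` if it is the germ of a section of degree `i`. -/
def StalkHasDeg (m : X.carrier) (i : Deg n) (s : X.Stalk m) : Prop :=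
  ∃ (U : Opens X.carrier) (hm : m ∈ U), ∃ f ∈ X.deg U i, X.germ ⟨m, hm⟩ f = s

/-- An ideal of the stalk is homogeneous if each of its elements is a sum of homogeneous elements
of the ideal. (Homogeneous left ideals of a `ℤ₂ⁿ`-commutative algebra are two-sided.) -/
def IsHomogeneousIdeal (m : X.carrier) (I : Ideal (X.Stalk m)) : Prop :=
  ∀ s ∈ I, ∃ c : Deg n → X.Stalk m, (∀ i, X.StalkHasDeg m i (c i) ∧ c i ∈ I) ∧ s = ∑ i, c i

/-- A maximal homogeneous ideal of the stalk: a proper homogeneous ideal that is maximal among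
the proper homogeneous ideals. -/
def IsMaximalHomogeneousIdeal (m : X.carrier) (I : Ideal (X.Stalk m)) : Prop :=
  Maximal (fun J : Ideal (X.Stalk m) => X.IsHomogeneousIdeal m J ∧ J ≠ ⊤) I

/-! #### The projection to the base -/

/-- The section `f - k` is not invertible in any neighbourhood of `m`. -/
def IsValueAt {U : Opens X.carrier} (f : X.Sec U) (m : U) (k : ℝ) : Prop :=
  ∀ (W : Opens X.carrier) (h : W ≤ U), m.1 ∈ W → ¬ IsUnit (X.res h (f - algebraMap ℝ (X.Sec U) k))

/-- The projection `ε_U` to the base: `ε_U(f)(m)` is the unique `k` such that `f - k` is not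
invertible in any neighbourhood of `m`. -/
noncomputable def eps {U : Opens X.carrier} (f : X.Sec U) : U → ℝ :=
  fun m => Classical.epsilon fun k => X.IsValueAt f m k

/-- The kernel `𝒥(U)` of `ε_U`. -/
def kerEps (U : Opens X.carrier) : Set (X.Sec U) := {f | X.eps f = 0}

end RingedSpace

/-! ### Morphisms -/

/-- A morphism of `ℤ₂ⁿ`-ringed spaces: a continuous base map and pullback maps, which are graded
unital `ℝ`-algebra morphisms and commute with restrictions. The condition that the induced maps
between stalks respect maximal homogeneous ideals is not imposed. -/
structure Hom {n : ℕ} (X : RingedSpace.{u, v} n) (Y : RingedSpace.{u', v'} n) where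
  base : C(X.carrier, Y.carrier)
  pull : ∀ V : Opens Y.carrier, Y.Sec V →ₐ[ℝ] X.Sec (Opens.comap base V)
  pull_deg : ∀ V i, ∀ t ∈ Y.deg V i, pull V t ∈ X.deg (Opens.comap base V) i
  pull_res : ∀ {V W : Opens Y.carrier} (h : W ≤ V) (t : Y.Sec V),
    pull W (Y.res h t) = X.res (fun _ hx => h hx) (pull V t)

/-- The map between stalks induced by a morphism: the germ of `t` at `ψ(m)` is sent to the germ
of `ψ^* t` at `m`. -/
noncomputable def Hom.stalkMap {n : ℕ} {X : RingedSpace.{u, v} n} {Y : RingedSpace.{u', v'} n} (Ψ : Hom X Y)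
    (m : X.carrier) : Y.Stalk (Ψ.base m) →+* X.Stalk m :=
  DirectLimit.Ring.lift (fun V : Y.Nhd (Ψ.base m) => Y.Sec V.toOpens) (Y.nhdRes (Ψ.base m)) _
    (fun V => (X.germ (U := Opens.comap Ψ.base V.toOpens) ⟨m, V.2⟩).comp
      (Ψ.pull V.toOpens).toRingHom)
    (fun V W h t => by
      have := DirectLimit.Ring.of_f (f := X.nhdRes m)
        (i := ⟨OrderDual.toDual (Opens.comap Ψ.base V.toOpens), V.2⟩)
        (j := ⟨OrderDual.toDual (Opens.comap Ψ.base W.toOpens), W.2⟩)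
        (fun _ hx => h hx) (Ψ.pull V.toOpens t)
      refine Eq.trans ?_ this
      exact congrArg (X.germ (U := Opens.comap Ψ.base W.toOpens) ⟨m, W.2⟩)
        (Ψ.pull_res (show W.toOpens ≤ V.toOpens from h) t))

/-! ### `ℤ₂ⁿ`-supermanifolds -/

/-- The Euclidean space `ℝ^p`. -/
abbrev Euc (p : ℕ) : Type := EuclideanSpace ℝ (Fin p)

/-- The algebra `C^∞(W)` of smooth functions on an open subset of `ℝ^p`. -/
abbrev Smooth {p : ℕ} (W : Opens (Euc p)) : Type := C^∞⟮𝓘(ℝ, Euc p), W; 𝓘(ℝ, ℝ), ℝ⟯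

/-- The algebra `C^∞(W)[[ξ¹, …, ξ^q]]_σ` of `ℤ₂ⁿ`-functions of a `ℤ₂ⁿ`-superdomain. -/
abbrev DomainSec {n q p : ℕ} (σ : Fin q → Deg n) (W : Opens (Euc p)) : Type :=
  FormalSeries σ (Smooth W)

/-- Restriction of `ℤ₂ⁿ`-functions of a superdomain, coefficient by coefficient. -/
noncomputable def domainRes {n q p : ℕ} {σ : Fin q → Deg n} {W W' : Opens (Euc p)} (h : W' ≤ W)
    (f : DomainSec σ W) : DomainSec σ W' :=
  f.map (ContMDiffMap.restrictRingHom 𝓘(ℝ, Euc p) 𝓘(ℝ, ℝ) ℝ h)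

/-- A superchart: an isomorphism of `ℤ₂ⁿ`-ringed spaces from an open part `(U, 𝒜|_U)` of `X` to a
superdomain `(V, C^∞_V[[ξ¹, …, ξ^q]]_σ)` over an open subset `V` of `ℝ^p`. -/
structure Superchart {n : ℕ} (X : RingedSpace.{u, v} n) (p : ℕ) {q : ℕ} (σ : Fin q → Deg n) where
  /-- The base homeomorphism from `U = base.source` to `V = base.target`. -/
  base : OpenPartialHomeomorph X.carrier (Euc p)
  /-- The pullback of `ℤ₂ⁿ`-functions. -/
  pull : ∀ W : Opens (Euc p), (W : Set (Euc p)) ⊆ base.target →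
    (DomainSec σ W ≃ₐ[ℝ] X.Sec ⟨base.source ∩ base ⁻¹' W, base.isOpen_inter_preimage W.isOpen⟩)
  pull_deg : ∀ W hW i f, FormalSeries.HasDeg i f ↔ pull W hW f ∈ X.deg _ i
  pull_res : ∀ {W W' : Opens (Euc p)} (hW : (W : Set (Euc p)) ⊆ base.target) (h : W' ≤ W)
    (f : DomainSec σ W),
    pull W' (fun _ hx => hW (h hx)) (domainRes h f) = X.res (Set.inter_subset_inter_right _ (Set.preimage_mono h)) (pull W hW f)

/-- A `ℤ₂ⁿ`-supermanifold of dimension `p|σ`: a `ℤ₂ⁿ`-ringed space that is locally isomorphic to a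
superdomain with `p` variables of degree zero and with formal variables of the nonzero degrees
`σ 1, …, σ q`. -/
structure Supermanifold (n p : ℕ) {q : ℕ} (σ : Fin q → Deg n) extends RingedSpace.{u, v} n where
  deg_ne_zero : ∀ a, σ a ≠ 0
  exists_superchart : ∀ m : carrier, ∃ c : Superchart toRingedSpace p σ, m ∈ c.base.source

/-- The smooth structure of the base: its atlas consists of the base maps of the supercharts. -/
noncomputable instance {n p q : ℕ} {σ : Fin q → Deg n} (M : Supermanifold.{u, v} n p σ) :
    ChartedSpace (Euc p) M.carrier where
  atlas := {e | ∃ c : Superchart M.toRingedSpace p σ, c.base = e}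
  chartAt m := (M.exists_superchart m).choose.base
  mem_chart_source m := (M.exists_superchart m).choose_spec
  chart_mem_atlas _ := ⟨_, rfl⟩

end ZTwoN

/-!
Everything rests on one fact: a formal power series `F = ∑ F_μ ξ^μ` with smooth coefficients on `W`
is invertible if and only if its constant coefficient `F_0` has no zero on `W`
(`FormalSeries.isUnit_iff`, `isUnit_smooth_iff`). Indeed, after division by `F_0`, the series is
`1 - g` with `g` without constant term, and the geometric series `∑ g^k` is finite in each
coefficient. Hence, in any superchart, `f - k` is invertible near `m` unless `k` is the value at `m`
of the constant coefficient of `f`. So `ε(f)` is well defined and is the constant coefficient of any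
coordinate expression of `f` (`Superchart.isValueAt_iff`, `Supermanifold.eps_eq_repZero`); in
particular `ε` is an algebra morphism, it vanishes on sections of nonzero degree, and a section is
invertible near each point at which `ε(f) ≠ 0`.

It follows that `ε(f)` is smooth in the coordinates of every superchart. Applied to the coordinate
functions of a second superchart, regarded as sections, this gives the smoothness of the transition
maps. It also follows that the stalks are local, in the sense that every proper left ideal is
contained in the kernel of the evaluation at `m`; this kernel is homogeneous, and hence is the only
maximal homogeneous ideal (`Supermanifold.isMaximalHomogeneousIdeal_iff`).

A morphism `Ψ` preserves invertibility. If `ε(t)(ψ(m)) ≠ k`, then `t - k` is invertible near `ψ(m)`,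
so `ψ^* t - k` is invertible near `m` and `ε(ψ^* t)(m) ≠ k` (`Hom.eps_pull`). The statements on
`𝒥` and on the ideals of the stalks are immediate from this, and so is the smoothness of `ψ`, whose
components in a superchart are the projections of the sections `ψ^* x^i`.
-/

namespace ZTwoN

/-! ### Invertible formal power series -/

namespace FormalSeries

variable {n q : ℕ} {σ : Fin q → Deg n} {R : Type v} [CommRing R]

lemma admissible_zero (σ : Fin q → Deg n) : Admissible σ 0 := fun _ _ => by simp

/-- The constant coefficient, as a ring homomorphism `R[[ξ]] → R`. -/
def constCoeff (σ : Fin q → Deg n) (R : Type v) [CommRing R] : FormalSeries σ R →+* R where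
  toFun f := f.coeff 0
  map_one' := by simp [one_coeff]
  map_zero' := rfl
  map_add' _ _ := rfl
  map_mul' f g := by
    rw [mul_coeff _ _ (admissible_zero σ)]
    simp [reorderSign_zero_left]

lemma constCoeff_apply (f : FormalSeries σ R) : constCoeff σ R f = f.coeff 0 := rfl

lemma constCoeff_const (r : R) : constCoeff σ R (const σ R r) = r := by
  simp [constCoeff_apply, const_coeff]

lemma coeff_sum {ι : Type*} (s : Finset ι) (f : ι → FormalSeries σ R) (μ : Fin q →₀ ℕ) :
    (∑ i ∈ s, f i).coeff μ = ∑ i ∈ s, (f i).coeff μ :=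
  map_sum (⟨⟨fun f => f.coeff μ, rfl⟩, fun _ _ => rfl⟩ : FormalSeries σ R →+ R) f s

lemma mul_coeff_congr {f f' g g' : FormalSeries σ R} {μ : Fin q →₀ ℕ}
    (hf : ∀ ν ≤ μ, f.coeff ν = f'.coeff ν) (hg : ∀ ν ≤ μ, g.coeff ν = g'.coeff ν) :
    (f * g).coeff μ = (f' * g').coeff μ := by
  by_cases hμ : Admissible σ μ
  · rw [mul_coeff _ _ hμ, mul_coeff _ _ hμ]
    refine Finset.sum_congr rfl fun x hx => ?_
    rw [Finset.HasAntidiagonal.mem_antidiagonal] at hx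
    rw [hf _ (hx ▸ le_self_add), hg _ (hx ▸ le_add_self)]
  · rw [coeff_eq_zero _ _ hμ, coeff_eq_zero _ _ hμ]

/-- Powers of a series without constant term have arbitrarily high order. -/
lemma pow_coeff_eq_zero {g : FormalSeries σ R} (hg : g.coeff 0 = 0) (k : ℕ) :
    ∀ μ : Fin q →₀ ℕ, μ.degree < k → (g ^ k).coeff μ = 0 := by
  induction k with
  | zero => intro μ h; omega
  | succ k ih =>
    intro μ h
    rw [pow_succ']
    by_cases hμ : Admissible σ μ
    · rw [mul_coeff _ _ hμ]
      refine Finset.sum_eq_zero fun x hx => ?_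
      rw [Finset.HasAntidiagonal.mem_antidiagonal] at hx
      by_cases hx1 : x.1 = 0
      · simp [hx1, hg]
      · have h1 : x.1.degree ≠ 0 := by simpa [Finsupp.degree_eq_zero_iff] using hx1
        have h2 : x.1.degree + x.2.degree = μ.degree := by rw [← hx, map_add]
        rw [ih x.2 (by omega)]
        simp
    · exact coeff_eq_zero _ _ hμ

/-- The geometric series `∑ k, g ^ k` of a series `g` without constant term. The sum defining
the coefficient of `ξ^μ` stops at `k = |μ|`, since `g ^ k` has order at least `k`. -/
noncomputable def geom (g : FormalSeries σ R) : FormalSeries σ R where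
  coeff μ := (∑ k ∈ Finset.range (μ.degree + 1), g ^ k).coeff μ
  coeff_eq_zero _ h := coeff_eq_zero _ _ h

lemma geom_coeff {g : FormalSeries σ R} (hg : g.coeff 0 = 0) {N : ℕ} {μ : Fin q →₀ ℕ}
    (h : μ.degree < N) : (geom g).coeff μ = (∑ k ∈ Finset.range N, g ^ k).coeff μ := by
  change (∑ k ∈ Finset.range (μ.degree + 1), g ^ k).coeff μ = _
  rw [coeff_sum, coeff_sum]
  refine Finset.sum_subset (Finset.range_mono h) fun k _ hk => pow_coeff_eq_zero hg k μ ?_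
  simpa using hk

lemma degree_le_of_le {ν μ : Fin q →₀ ℕ} (h : ν ≤ μ) : ν.degree ≤ μ.degree := by
  obtain ⟨ρ, rfl⟩ := exists_add_of_le h
  simp

lemma isUnit_one_sub {g : FormalSeries σ R} (hg : g.coeff 0 = 0) : IsUnit (1 - g) := by
  have key : ∀ μ : Fin q →₀ ℕ,
      (1 - g ^ (μ.degree + 1)).coeff μ = (1 : FormalSeries σ R).coeff μ := by
    intro μ
    rw [sub_eq_add_neg, add_coeff, neg_coeff, pow_coeff_eq_zero hg _ _ (Nat.lt_succ_self _)]
    simp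
  have hge : ∀ μ : Fin q →₀ ℕ, ∀ ν ≤ μ,
      (geom g).coeff ν = (∑ k ∈ Finset.range (μ.degree + 1), g ^ k).coeff ν := fun μ ν h =>
    geom_coeff hg (Nat.lt_succ_of_le (degree_le_of_le h))
  refine ⟨⟨1 - g, geom g, ?_, ?_⟩, rfl⟩
  · ext μ
    rw [mul_coeff_congr (fun _ _ => rfl) (hge μ), mul_neg_geom_sum, key]
  · ext μ
    rw [mul_coeff_congr (hge μ) (fun _ _ => rfl), geom_sum_mul_neg, key]

/-- A formal power series is invertible if and only if its constant coefficient is. -/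
lemma isUnit_iff {f : FormalSeries σ R} : IsUnit f ↔ IsUnit (f.coeff 0) := by
  refine ⟨fun h => h.map (constCoeff σ R), fun h => ?_⟩
  obtain ⟨r, hr⟩ := h
  have h1 : IsUnit (1 - (1 - const σ R (↑r⁻¹ : R) * f)) := by
    refine isUnit_one_sub ?_
    rw [sub_eq_add_neg, add_coeff, neg_coeff, const_mul_coeff, ← hr]
    simp [one_coeff]
  rw [sub_sub_cancel] at h1
  have h2 : const σ R (r : R) * (const σ R (↑r⁻¹ : R) * f) = f := by
    rw [← mul_assoc, ← map_mul]
    simp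
  rw [← h2]
  exact ((r.isUnit).map (const σ R)).mul h1

end FormalSeries

/-! ### Smooth functions on open subsets of `ℝ^p` -/

section Smooth

variable {p : ℕ} {W : Opens (Euc p)}

lemma isUnit_smooth_iff {F : Smooth W} : IsUnit F ↔ ∀ x, F x ≠ 0 := by
  constructor
  · rintro ⟨⟨a, b, hab, _⟩, rfl⟩ x hx
    have h : a x * b x = 1 := congrArg (fun G : Smooth W => G x) hab
    change a x = 0 at hx
    rw [hx, zero_mul] at h
    exact zero_ne_one h
  · intro h
    have hinv : ContMDiff 𝓘(ℝ, Euc p) 𝓘(ℝ, ℝ) ∞ fun x : W => (F x)⁻¹ := fun x =>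
      (F.contMDiff x).inv₀ (h x)
    refine IsUnit.of_mul_eq_one ⟨_, hinv⟩ ?_
    ext x
    exact mul_inv_cancel₀ (h x)

/-- The element of `C^∞(W)` given by a function that is smooth on `W`. -/
def smoothOfContDiffOn {g : Euc p → ℝ} (hg : ContDiffOn ℝ ∞ g W) : Smooth W :=
  ⟨fun x => g x, fun x => contMDiffAt_subtype_iff.2
    ((hg.contDiffAt (W.isOpen.mem_nhds x.2)).contMDiffAt)⟩

lemma smoothOfContDiffOn_apply {g : Euc p → ℝ} (hg : ContDiffOn ℝ ∞ g W) (x : W) :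
    smoothOfContDiffOn hg x = g x := rfl

lemma contDiffAt_of_smooth (F : Smooth W) {g : Euc p → ℝ} (hg : ∀ x : W, g x = F x) (x : W) :
    ContDiffAt ℝ ∞ g x := by
  rw [← contMDiffAt_iff_contDiffAt]
  refine contMDiffAt_subtype_iff.1 ?_
  have : (fun x : W => g x) = F := funext hg
  rw [this]
  exact F.contMDiff x

end Smooth

/-! ### Sections in superchart coordinates -/

namespace Superchart

variable {n p q : ℕ} {σ : Fin q → Deg n} {X : RingedSpace.{u, v} n} (c : Superchart X p σ)

/-- The open subset of the domain of a superchart that corresponds to `W ⊆ ℝ^p`. -/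
abbrev pre (W : Opens (Euc p)) : Opens X.carrier :=
  ⟨c.base.source ∩ c.base ⁻¹' W, c.base.isOpen_inter_preimage W.isOpen⟩

/-- The open subset of `ℝ^p` that corresponds to the part of `U` inside the domain of a
superchart. -/
def im (U : Opens X.carrier) : Opens (Euc p) :=
  ⟨c.base.target ∩ c.base.symm ⁻¹' U, c.base.isOpen_inter_preimage_symm U.isOpen⟩

lemma im_subset (U : Opens X.carrier) : (c.im U : Set (Euc p)) ⊆ c.base.target :=
  Set.inter_subset_left

lemma pre_im_le (U : Opens X.carrier) : c.pre (c.im U) ≤ U := fun x hx => by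
  have h2 : c.base.symm (c.base x) ∈ U := hx.2.2
  rwa [c.base.left_inv hx.1] at h2

lemma base_mem_im {U : Opens X.carrier} {x : X.carrier} (hx : x ∈ c.base.source) (hU : x ∈ U) :
    c.base x ∈ c.im U :=
  ⟨c.base.map_source hx, by simpa [c.base.left_inv hx] using hU⟩

/-- The coordinate expression on `W` of a section: its restriction, read as a power series with
smooth coefficients. -/
noncomputable def rep {U : Opens X.carrier} (f : X.Sec U) (W : Opens (Euc p))
    (hW : (W : Set (Euc p)) ⊆ c.base.target) (h : c.pre W ≤ U) : DomainSec σ W :=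
  (c.pull W hW).symm (X.res h f)

lemma pull_rep {U : Opens X.carrier} (f : X.Sec U) (W : Opens (Euc p))
    (hW : (W : Set (Euc p)) ⊆ c.base.target) (h : c.pre W ≤ U) :
    c.pull W hW (c.rep f W hW h) = X.res h f :=
  (c.pull W hW).apply_symm_apply _

lemma pre_mono {W W' : Opens (Euc p)} (h : W' ≤ W) : c.pre W' ≤ c.pre W :=
  Set.inter_subset_inter_right _ (Set.preimage_mono h)

lemma rep_res {U U' : Opens X.carrier} (hU : U' ≤ U) (f : X.Sec U) (W : Opens (Euc p))
    (hW : (W : Set (Euc p)) ⊆ c.base.target) (h : c.pre W ≤ U') :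
    c.rep (X.res hU f) W hW h = c.rep f W hW (h.trans hU) := by
  rw [rep, X.res_res, rep]

lemma rep_mono {U : Opens X.carrier} (f : X.Sec U) {W W' : Opens (Euc p)}
    (hW : (W : Set (Euc p)) ⊆ c.base.target) (h : c.pre W ≤ U)
    (hW' : (W' : Set (Euc p)) ⊆ c.base.target) (h' : c.pre W' ≤ U) (hWW : W' ≤ W) :
    c.rep f W' hW' h' = domainRes hWW (c.rep f W hW h) := by
  refine (c.pull W' hW').injective ?_
  rw [c.pull_rep]
  refine Eq.trans ?_ (c.pull_res hW hWW _).symm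
  rw [c.pull_rep]
  exact (X.res_res h (c.pre_mono hWW) f).symm

/-- The constant coefficient of the coordinate expression of a section. -/
noncomputable def repZero {U : Opens X.carrier} (W : Opens (Euc p))
    (hW : (W : Set (Euc p)) ⊆ c.base.target) (h : c.pre W ≤ U) : X.Sec U →+* Smooth W :=
  (FormalSeries.constCoeff σ (Smooth W)).comp
    (((c.pull W hW).symm : X.Sec (c.pre W) →+* DomainSec σ W).comp (X.res h : X.Sec U →+* _))

lemma repZero_apply {U : Opens X.carrier} (f : X.Sec U) (W : Opens (Euc p))
    (hW : (W : Set (Euc p)) ⊆ c.base.target) (h : c.pre W ≤ U) :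
    c.repZero W hW h f = (c.rep f W hW h).coeff 0 := rfl

lemma repZero_mono {U : Opens X.carrier} (f : X.Sec U) {W W' : Opens (Euc p)}
    (hW : (W : Set (Euc p)) ⊆ c.base.target) (h : c.pre W ≤ U)
    (hW' : (W' : Set (Euc p)) ⊆ c.base.target) (h' : c.pre W' ≤ U) (hWW : W' ≤ W) (x : W') :
    c.repZero W' hW' h' f x = c.repZero W hW h f ⟨x, hWW x.2⟩ := by
  rw [repZero_apply, c.rep_mono f hW h hW' h' hWW]
  rfl

lemma repZero_algebraMap {U : Opens X.carrier} (k : ℝ) (W : Opens (Euc p))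
    (hW : (W : Set (Euc p)) ⊆ c.base.target) (h : c.pre W ≤ U) (x : W) :
    c.repZero W hW h (algebraMap ℝ (X.Sec U) k) x = k := by
  have h1 : c.rep (algebraMap ℝ (X.Sec U) k) W hW h = algebraMap ℝ (DomainSec σ W) k := by
    rw [rep, AlgHom.commutes, AlgEquiv.commutes]
  rw [repZero_apply, h1]
  change (FormalSeries.const σ (Smooth W) (algebraMap ℝ (Smooth W) k)).coeff 0 x = k
  rw [← FormalSeries.constCoeff_apply, FormalSeries.constCoeff_const]
  rfl

lemma isUnit_res_iff {U : Opens X.carrier} (f : X.Sec U) (W : Opens (Euc p))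
    (hW : (W : Set (Euc p)) ⊆ c.base.target) (h : c.pre W ≤ U) :
    IsUnit (X.res h f) ↔ ∀ x, c.repZero W hW h f x ≠ 0 := by
  rw [← isUnit_smooth_iff, repZero_apply, ← FormalSeries.isUnit_iff, rep,
    MulEquiv.isUnit_map]

/-- The value of a section at a point is the constant coefficient of any coordinate expression. -/
lemma isValueAt_iff {U : Opens X.carrier} (f : X.Sec U) (m : U) (hm : m.1 ∈ c.base.source)
    (k : ℝ) (W : Opens (Euc p)) (hW : (W : Set (Euc p)) ⊆ c.base.target) (h : c.pre W ≤ U)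
    (hmW : c.base m ∈ W) :
    X.IsValueAt f m k ↔ k = c.repZero W hW h f ⟨c.base m, hmW⟩ := by
  have hk : ∀ x : W, c.repZero W hW h (f - algebraMap ℝ _ k) x = c.repZero W hW h f x - k := by
    intro x
    rw [map_sub]
    change c.repZero W hW h f x - c.repZero W hW h (algebraMap ℝ _ k) x = _
    rw [c.repZero_algebraMap]
  constructor
  · intro hv
    by_contra hne
    -- `f - k` is invertible where its constant coefficient does not vanish.
    have hcont : Continuous fun x : W => c.repZero W hW h f x :=
      (c.repZero W hW h f).contMDiff.continuous
    have hopen : IsOpen ((↑) '' {x : W | c.repZero W hW h f x ≠ k} : Set (Euc p)) :=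
      W.isOpen.isOpenMap_subtype_val _ (isOpen_ne_fun hcont continuous_const)
    let W' : Opens (Euc p) := ⟨_, hopen⟩
    have hWW : W' ≤ W := by
      rintro _ ⟨x, -, rfl⟩
      exact x.2
    refine hv (c.pre W') ((c.pre_mono hWW).trans h) ⟨hm, ⟨_, hmW⟩, Ne.symm hne, rfl⟩ ?_
    rw [c.isUnit_res_iff _ W' (Set.Subset.trans hWW hW)]
    rintro ⟨_, x, hx, rfl⟩
    rw [c.repZero_mono _ hW h _ _ hWW, hk]
    exact sub_ne_zero.2 hx
  · rintro rfl U' hU' hmU' hu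
    have hle : c.im U' ⊓ W ≤ W := inf_le_right
    have hle' : c.pre (c.im U' ⊓ W) ≤ U' := (c.pre_mono inf_le_left).trans (c.pre_im_le U')
    have hu' := hu.map (X.res hle')
    rw [X.res_res, c.isUnit_res_iff _ _ (Set.Subset.trans hle hW)] at hu'
    refine hu' ⟨c.base m, c.base_mem_im hm hmU', hmW⟩ ?_
    rw [c.repZero_mono _ hW h _ _ hle, hk, sub_self]

end Superchart

/-! ### The projection to the base -/

namespace Supermanifold

variable {n p q : ℕ} {σ : Fin q → Deg n} (M : Supermanifold.{u, v} n p σ)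

lemma isValueAt_iff {U : Opens M.carrier} (f : M.Sec U) (m : U) (k : ℝ) :
    M.IsValueAt f m k ↔ k = M.eps f m := by
  obtain ⟨c, hc⟩ := M.exists_superchart m
  have h := fun l => c.isValueAt_iff f m hc l (c.im U) (c.im_subset U) (c.pre_im_le U)
    (c.base_mem_im hc m.2)
  have h1 : M.IsValueAt f m (M.eps f m) := Classical.epsilon_spec ⟨_, (h _).2 rfl⟩
  rw [h, ← (h _).1 h1]

variable {M}

lemma eps_eq_repZero {U : Opens M.carrier} (f : M.Sec U) (c : Superchart M.toRingedSpace p σ)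
    {m : M.carrier} (hmU : m ∈ U) (hm : m ∈ c.base.source) (W : Opens (Euc p))
    (hW : (W : Set (Euc p)) ⊆ c.base.target) (h : c.pre W ≤ U) (hmW : c.base m ∈ W) :
    M.eps f ⟨m, hmU⟩ = c.repZero W hW h f ⟨c.base m, hmW⟩ :=
  (c.isValueAt_iff f ⟨m, hmU⟩ hm _ W hW h hmW).1 ((M.isValueAt_iff f _ _).2 rfl)

lemma eps_res {U U' : Opens M.carrier} (h : U' ≤ U) (f : M.Sec U) (m : U') :
    M.eps (M.res h f) m = M.eps f ⟨m, h m.2⟩ := by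
  obtain ⟨c, hc⟩ := M.exists_superchart m
  rw [eps_eq_repZero (m := m) _ c m.2 hc (c.im U') (c.im_subset U') (c.pre_im_le U')
      (c.base_mem_im hc m.2),
    eps_eq_repZero f c _ hc (c.im U') (c.im_subset U') ((c.pre_im_le U').trans h)
      (c.base_mem_im hc m.2), c.repZero_apply, c.rep_res]
  rfl

variable (M) in
/-- The projection to the base, as a ring homomorphism. -/
noncomputable def epsHom (U : Opens M.carrier) : M.Sec U →+* (U → ℝ) where
  toFun f := M.eps f
  map_one' := funext fun m => by
    obtain ⟨c, hc⟩ := M.exists_superchart m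
    rw [← Subtype.coe_eta m m.2, eps_eq_repZero _ c m.2 hc (c.im U) (c.im_subset U)
      (c.pre_im_le U) (c.base_mem_im hc m.2), map_one]
    rfl
  map_zero' := funext fun m => by
    obtain ⟨c, hc⟩ := M.exists_superchart m
    rw [← Subtype.coe_eta m m.2, eps_eq_repZero _ c m.2 hc (c.im U) (c.im_subset U)
      (c.pre_im_le U) (c.base_mem_im hc m.2), map_zero]
    rfl
  map_add' f g := funext fun m => by
    obtain ⟨c, hc⟩ := M.exists_superchart m
    have h := fun f : M.Sec U => eps_eq_repZero f c m.2 hc (c.im U) (c.im_subset U)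
      (c.pre_im_le U) (c.base_mem_im hc m.2)
    rw [Pi.add_apply, ← Subtype.coe_eta m m.2, h, h, h, map_add]
    rfl
  map_mul' f g := funext fun m => by
    obtain ⟨c, hc⟩ := M.exists_superchart m
    have h := fun f : M.Sec U => eps_eq_repZero f c m.2 hc (c.im U) (c.im_subset U)
      (c.pre_im_le U) (c.base_mem_im hc m.2)
    rw [Pi.mul_apply, ← Subtype.coe_eta m m.2, h, h, h, map_mul]
    rfl

lemma epsHom_apply {U : Opens M.carrier} (f : M.Sec U) : M.epsHom U f = M.eps f := rfl

lemma eps_sub_algebraMap {U : Opens M.carrier} (f : M.Sec U) (k : ℝ) (m : U) :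
    M.eps (f - algebraMap ℝ _ k) m = M.eps f m - k := by
  have h : M.eps (algebraMap ℝ (M.Sec U) k) m = k := by
    refine ((M.isValueAt_iff _ _ _).1 fun W hW hmW => ?_).symm
    rw [sub_self, map_zero]
    intro hu
    obtain ⟨c, hc⟩ := M.exists_superchart m
    have h0 := eps_eq_repZero (0 : M.Sec W) c hmW hc (c.im W) (c.im_subset W)
      (c.pre_im_le W) (c.base_mem_im hc hmW)
    rw [map_zero] at h0
    have h1 := hu.map (M.epsHom W)
    rw [Pi.isUnit_iff] at h1
    exact (h1 ⟨m, hmW⟩).ne_zero h0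
  rw [← epsHom_apply, map_sub, Pi.sub_apply, epsHom_apply, epsHom_apply, h]

/-- A section with nonzero value at a point is invertible near that point. -/
lemma exists_isUnit_res {U : Opens M.carrier} {f : M.Sec U} {m : U} (h : M.eps f m ≠ 0) :
    ∃ (W : Opens M.carrier) (hW : W ≤ U), m.1 ∈ W ∧ IsUnit (M.res hW f) := by
  have h1 := mt (M.isValueAt_iff f m 0).1 h.symm
  simpa [RingedSpace.IsValueAt] using h1

/-- Homogeneous sections of nonzero degree have no constant coefficient. -/
lemma eps_eq_zero_of_mem_deg {U : Opens M.carrier} {i : Deg n} (hi : i ≠ 0) {f : M.Sec U}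
    (hf : f ∈ M.deg U i) : M.eps f = 0 := by
  funext m
  obtain ⟨c, hc⟩ := M.exists_superchart m
  have h1 : (c.rep f _ (c.im_subset U) (c.pre_im_le U)).HasDeg i := by
    rw [c.pull_deg _ (c.im_subset U), c.pull_rep]
    exact M.res_deg _ i f hf
  have h2 : c.repZero _ (c.im_subset U) (c.pre_im_le U) f = 0 := by
    by_contra hne
    exact hi (by simpa using (h1 0 hne).symm)
  rw [← Subtype.coe_eta m m.2, eps_eq_repZero f c m.2 hc _ (c.im_subset U) (c.pre_im_le U)
    (c.base_mem_im hc m.2), h2]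
  rfl

end Supermanifold

/-! ### The smooth structure of the base -/

namespace Supermanifold

variable {n p q : ℕ} {σ : Fin q → Deg n} {M : Supermanifold.{u, v} n p σ}

/-- In the coordinates of any superchart, the projection of a section is smooth. -/
lemma contDiffAt_eps_comp_symm {U : Opens M.carrier} (f : M.Sec U) {g : M.carrier → ℝ}
    (hg : ∀ x : U, g x = M.eps f x) (c : Superchart M.toRingedSpace p σ) {y : Euc p}
    (hy : y ∈ c.im U) : ContDiffAt ℝ ∞ (g ∘ c.base.symm) y := by
  refine contDiffAt_of_smooth (c.repZero (c.im U) (c.im_subset U) (c.pre_im_le U) f)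
    (fun z => ?_) ⟨y, hy⟩
  have hz : c.base (c.base.symm z) = z := c.base.right_inv z.2.1
  rw [Function.comp_apply, hg ⟨_, z.2.2⟩, eps_eq_repZero f c z.2.2 (c.base.map_target z.2.1)
    (c.im U) (c.im_subset U) (c.pre_im_le U) (by rw [hz]; exact z.2)]
  congr 1
  exact Subtype.ext hz

/-- Smooth functions of the coordinates of a superchart lift to sections. -/
lemma exists_eps_eq (c : Superchart M.toRingedSpace p σ) {W : Opens (Euc p)}
    (hW : (W : Set (Euc p)) ⊆ c.base.target) {g : Euc p → ℝ} (hg : ContDiffOn ℝ ∞ g W) :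
    ∃ f : M.Sec (c.pre W), ∀ x : c.pre W, M.eps f x = g (c.base x) := by
  refine ⟨c.pull W hW (FormalSeries.const σ _ (smoothOfContDiffOn hg)), fun x => ?_⟩
  rw [← Subtype.coe_eta x x.2, eps_eq_repZero _ c x.2 x.2.1 W hW le_rfl x.2.2, c.repZero_apply,
    Superchart.rep, M.res_self, AlgEquiv.symm_apply_apply, ← FormalSeries.constCoeff_apply,
    FormalSeries.constCoeff_const, smoothOfContDiffOn_apply]

/-- Each coordinate function of a superchart is the projection of a section. -/
lemma exists_eps_eq_coord (c : Superchart M.toRingedSpace p σ) (i : Fin p) :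
    ∃ (U : Opens M.carrier) (f : M.Sec U), (U : Set M.carrier) = c.base.source ∧
      ∀ x : U, M.eps f x = c.base x i := by
  obtain ⟨f, hf⟩ := exists_eps_eq c (W := ⟨c.base.target, c.base.open_target⟩) subset_rfl
    (g := fun y => y i) (contDiff_euclidean.1 contDiff_id i).contDiffOn
  refine ⟨_, f, ?_, hf⟩
  exact Set.inter_eq_left.2 c.base.source_preimage_target

instance : IsManifold 𝓘(ℝ, Euc p) ∞ M.carrier := by
  refine isManifold_of_contDiffOn _ _ _ ?_
  rintro _ _ ⟨c, rfl⟩ ⟨c', rfl⟩ y hy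
  obtain ⟨hy1, hy2⟩ : y ∈ c.base.target ∧ c.base.symm y ∈ c'.base.source := by simpa using hy
  refine ContDiffAt.contDiffWithinAt ?_
  refine contDiffAt_euclidean.2 fun i => ?_
  obtain ⟨U, f, hU, hf⟩ := exists_eps_eq_coord c' i
  exact contDiffAt_eps_comp_symm f (g := fun x => c'.base x i) (fun x => (hf x).symm) c
    ⟨hy1, hU.symm ▸ hy2⟩

lemma base_mem_maximalAtlas (c : Superchart M.toRingedSpace p σ) :
    c.base ∈ IsManifold.maximalAtlas 𝓘(ℝ, Euc p) ∞ M.carrier :=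
  StructureGroupoid.subset_maximalAtlas _ ⟨c, rfl⟩

lemma contMDiffAt_of_eq_eps {U : Opens M.carrier} (f : M.Sec U) {g : M.carrier → ℝ}
    (hg : ∀ x : U, g x = M.eps f x) {m : M.carrier} (hm : m ∈ U) :
    ContMDiffAt 𝓘(ℝ, Euc p) 𝓘(ℝ, ℝ) ∞ g m := by
  obtain ⟨c, hc⟩ := M.exists_superchart m
  have h1 := (contDiffAt_eps_comp_symm f hg c (c.base_mem_im hc hm)).contMDiffAt.comp m
    (contMDiffAt_of_mem_maximalAtlas (base_mem_maximalAtlas c) hc)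
  refine h1.congr_of_eventuallyEq ?_
  filter_upwards [c.base.open_source.mem_nhds hc] with x hx
  simp [c.base.left_inv hx]

/-- The smooth functions on the base are locally the projections of sections. -/
lemma contMDiffOn_iff_eps (U : Opens M.carrier) (g : M.carrier → ℝ) :
    ContMDiffOn 𝓘(ℝ, Euc p) 𝓘(ℝ, ℝ) ∞ g (U : Set M.carrier) ↔
      ∀ m ∈ U, ∃ W : Opens M.carrier, m ∈ W ∧ W ≤ U ∧
        ∃ f : M.Sec W, ∀ x : W, g x = M.eps f x := by
  constructor
  · intro hg m hm
    obtain ⟨c, hc⟩ := M.exists_superchart m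
    have hsm : ContDiffOn ℝ ∞ (g ∘ c.base.symm) (c.im U) := by
      rw [← contMDiffOn_iff_contDiffOn]
      exact hg.comp ((contMDiffOn_symm_of_mem_maximalAtlas (base_mem_maximalAtlas c)).mono
        (c.im_subset U)) fun y hy => hy.2
    obtain ⟨f, hf⟩ := exists_eps_eq c (c.im_subset U) hsm
    refine ⟨c.pre (c.im U), ⟨hc, c.base_mem_im hc hm⟩, c.pre_im_le U, f, fun x => ?_⟩
    rw [hf, Function.comp_apply, c.base.left_inv x.2.1]
  · intro h m hm
    obtain ⟨W, hmW, -, f, hf⟩ := h m hm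
    exact (contMDiffAt_of_eq_eps f hf hmW).contMDiffWithinAt

end Supermanifold

/-! ### Stalks -/

namespace RingedSpace

variable {n : ℕ} (X : RingedSpace.{u, v} n)

lemma exists_germ {m : X.carrier} (s : X.Stalk m) :
    ∃ (U : Opens X.carrier) (hm : m ∈ U) (f : X.Sec U), X.germ ⟨m, hm⟩ f = s := by
  obtain ⟨U, f, rfl⟩ := DirectLimit.exists_eq_mk _ s
  exact ⟨U.toOpens, U.2, f, rfl⟩

lemma germ_res {U V : Opens X.carrier} (h : V ≤ U) (f : X.Sec U) {m : X.carrier} (hm : m ∈ V) :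
    X.germ ⟨m, hm⟩ (X.res h f) = X.germ ⟨m, h hm⟩ f :=
  DirectLimit.Ring.of_f (f := X.nhdRes m) (i := ⟨OrderDual.toDual U, h hm⟩)
    (j := ⟨OrderDual.toDual V, hm⟩) h f

end RingedSpace

namespace Supermanifold

variable {n p q : ℕ} {σ : Fin q → Deg n} (M : Supermanifold.{u, v} n p σ)

/-- The value of a germ at `m`: the germ of `f` is sent to `ε(f)(m)`. -/
noncomputable def stalkEval (m : M.carrier) : M.Stalk m →+* ℝ :=
  DirectLimit.Ring.lift (fun U : M.Nhd m => M.Sec U.toOpens) (M.nhdRes m) _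
    (fun U => (Pi.evalRingHom (fun _ : U.toOpens => ℝ) ⟨m, U.2⟩).comp (M.epsHom U.toOpens))
    (fun U V h f => eps_res (show V.toOpens ≤ U.toOpens from h) f ⟨m, V.2⟩)

lemma isUnit_of_stalkEval_ne_zero {m : M.carrier} {s : M.Stalk m} (h : M.stalkEval m s ≠ 0) :
    IsUnit s := by
  obtain ⟨U, hm, f, rfl⟩ := M.exists_germ s
  obtain ⟨W, hW, hmW, hu⟩ := exists_isUnit_res (m := ⟨m, hm⟩) h
  rw [← M.germ_res hW f hmW]
  exact hu.map _

lemma isHomogeneousIdeal_ker_stalkEval (m : M.carrier) :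
    M.IsHomogeneousIdeal m (RingHom.ker (M.stalkEval m)) := by
  intro s hs
  obtain ⟨U, hm, f, rfl⟩ := M.exists_germ s
  have hf : M.eps f ⟨m, hm⟩ = 0 := hs
  have htop : f ∈ ⨆ i ∈ (Finset.univ : Finset (Deg n)), M.deg U i := by
    simp [(M.isInternal U).submodule_iSup_eq_top]
  obtain ⟨c, hc⟩ := (Submodule.mem_iSup_finset_iff_exists_sum _ _).1 htop
  have hne : ∀ i ≠ 0, M.eps (c i : M.Sec U) = 0 := fun i hi => eps_eq_zero_of_mem_deg hi (c i).2
  have hsum : M.eps f = M.eps (c 0 : M.Sec U) := by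
    rw [← hc, ← epsHom_apply, map_sum]
    exact Finset.sum_eq_single 0 (fun i _ hi => hne i hi) (fun h => absurd (Finset.mem_univ _) h)
  refine ⟨fun i => M.germ ⟨m, hm⟩ (c i : M.Sec U), fun i => ⟨⟨U, hm, _, (c i).2, rfl⟩, ?_⟩, ?_⟩
  · change M.eps (c i : M.Sec U) ⟨m, hm⟩ = 0
    by_cases hi : i = 0
    · subst hi
      rw [← hsum, hf]
    · rw [hne i hi]
      rfl
  · rw [← map_sum, hc]

lemma le_ker_stalkEval {m : M.carrier} {I : Ideal (M.Stalk m)} (hI : I ≠ ⊤) :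
    I ≤ RingHom.ker (M.stalkEval m) := fun _ hs => by
  by_contra h
  exact hI (Ideal.eq_top_of_isUnit_mem _ hs (M.isUnit_of_stalkEval_ne_zero h))

/-- The stalks are local: the germs with value zero form the only maximal homogeneous ideal. -/
lemma isMaximalHomogeneousIdeal_iff {m : M.carrier} {I : Ideal (M.Stalk m)} :
    M.IsMaximalHomogeneousIdeal m I ↔ I = RingHom.ker (M.stalkEval m) := by
  have hker : M.IsHomogeneousIdeal m (RingHom.ker (M.stalkEval m)) ∧
      RingHom.ker (M.stalkEval m) ≠ ⊤ :=
    ⟨M.isHomogeneousIdeal_ker_stalkEval m, RingHom.ker_ne_top _⟩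
  constructor
  · intro h
    exact h.eq_of_le hker (M.le_ker_stalkEval h.prop.2)
  · rintro rfl
    exact ⟨hker, fun J hJ _ => M.le_ker_stalkEval hJ.2⟩

end Supermanifold

/-! ### Morphisms -/

namespace Hom

variable {n p q p' q' : ℕ} {σ : Fin q → Deg n} {σ' : Fin q' → Deg n}
  {M : Supermanifold.{u, v} n p σ} {N : Supermanifold.{u', v'} n p' σ'}
  (Ψ : Hom M.toRingedSpace N.toRingedSpace)

/-- A morphism pulls inverses back to inverses, so that it preserves values of sections. -/
lemma eps_pull {V : Opens N.carrier} (t : N.Sec V) (m : Opens.comap Ψ.base V) :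
    M.eps (Ψ.pull V t) m = N.eps t ⟨Ψ.base m, m.2⟩ := by
  by_contra hne
  obtain ⟨W, hW, hmW, hu⟩ := Supermanifold.exists_isUnit_res
    (f := t - algebraMap ℝ _ (M.eps (Ψ.pull V t) m)) (m := ⟨Ψ.base m, m.2⟩)
    (by rw [Supermanifold.eps_sub_algebraMap]; exact sub_ne_zero.2 (Ne.symm hne))
  have hu' := hu.map (Ψ.pull W)
  rw [Ψ.pull_res, map_sub, AlgHom.commutes] at hu'
  exact (M.isValueAt_iff _ _ _).2 rfl _ _ hmW hu'

lemma stalkEval_stalkMap {m : M.carrier} (s : N.Stalk (Ψ.base m)) :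
    M.stalkEval m (Ψ.stalkMap m s) = N.stalkEval (Ψ.base m) s := by
  obtain ⟨V, hm, t, rfl⟩ := N.exists_germ s
  exact Ψ.eps_pull t ⟨m, hm⟩

/-- In supercharts of the target, the components of the base map are projections of the
pullbacks of the coordinate sections. -/
lemma contMDiff_base : ContMDiff 𝓘(ℝ, Euc p) 𝓘(ℝ, Euc p') ∞ Ψ.base := by
  intro m
  obtain ⟨c, hc⟩ := N.exists_superchart (Ψ.base m)
  have hcoord : ContMDiffAt 𝓘(ℝ, Euc p) 𝓘(ℝ, Euc p') ∞ (c.base ∘ Ψ.base) m := by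
    have hpi : ContMDiffAt 𝓘(ℝ, Euc p) 𝓘(ℝ, Fin p' → ℝ) ∞
        (fun x => WithLp.ofLp (c.base (Ψ.base x))) m := by
      refine contMDiffAt_pi_space.2 fun i => ?_
      obtain ⟨U, f, hU, hf⟩ := Supermanifold.exists_eps_eq_coord c i
      refine Supermanifold.contMDiffAt_of_eq_eps (U := Opens.comap Ψ.base U) (Ψ.pull U f)
        (fun x => ?_) (m := m) (show Ψ.base m ∈ (U : Set N.carrier) from hU ▸ hc)
      rw [eps_pull, hf]
    exact ((PiLp.continuousLinearEquiv 2 ℝ fun _ : Fin p' => ℝ).symm.contDiff.contMDiff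
      _).comp m hpi
  have hcomp := (contMDiffAt_symm_of_mem_maximalAtlas
    (Supermanifold.base_mem_maximalAtlas c) (c.base.map_source hc)).comp m hcoord
  refine hcomp.congr_of_eventuallyEq ?_
  filter_upwards [Ψ.base.continuous.continuousAt (c.base.open_source.mem_nhds hc)] with x hx
  exact (c.base.left_inv hx).symm

end Hom

end ZTwoN

theorem proposition6p3 {n p q p' q' : ℕ} {σ : Fin q → ZTwoN.Deg n} {σ' : Fin q' → ZTwoN.Deg n}
    (M : ZTwoN.Supermanifold.{u, v} n p σ) (N : ZTwoN.Supermanifold.{u', v'} n p' σ') :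
    -- the projection to the base is well defined
    (∀ (U : Opens M.carrier) (f : M.Sec U) (m : U) (k : ℝ), M.IsValueAt f m k ↔ k = M.eps f m) ∧
    -- the base is a smooth manifold, whose smooth functions are locally the projections
    -- of sections
    IsManifold 𝓘(ℝ, ZTwoN.Euc p) ∞ M.carrier ∧
    (∀ (U : Opens M.carrier) (g : M.carrier → ℝ),
      ContMDiffOn 𝓘(ℝ, ZTwoN.Euc p) 𝓘(ℝ, ℝ) ∞ g (U : Set M.carrier) ↔
        ∀ m ∈ U, ∃ W : Opens M.carrier, m ∈ W ∧ W ≤ U ∧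
          ∃ f : M.Sec W, ∀ x : W, g x = M.eps f x) ∧
    -- the maximal homogeneous ideals of the stalks
    (∀ m : M.carrier, ∃! I : Ideal (M.Stalk m), M.IsMaximalHomogeneousIdeal m I) ∧
    (∀ (m : M.carrier) (I : Ideal (M.Stalk m)), M.IsMaximalHomogeneousIdeal m I →
      (I : Set (M.Stalk m)) = {s | ∃ (U : Opens M.carrier) (hm : m ∈ U) (f : M.Sec U),
        M.germ ⟨m, hm⟩ f = s ∧ M.eps f ⟨m, hm⟩ = 0}) ∧
    ∀ Ψ : ZTwoN.Hom M.toRingedSpace N.toRingedSpace,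
      -- pullback commutes with the projection to the base
      (∀ (V : Opens N.carrier) (t : N.Sec V),
        M.eps (Ψ.pull V t) = N.eps t ∘ Set.restrictPreimage (V : Set N.carrier) Ψ.base) ∧
      -- continuity
      (∀ V : Opens N.carrier,
        Ψ.pull V '' N.kerEps V ⊆ M.kerEps (Opens.comap Ψ.base V)) ∧
      (∀ (m : M.carrier) (I : Ideal (N.Stalk (Ψ.base m))) (J : Ideal (M.Stalk m)),
        N.IsMaximalHomogeneousIdeal (Ψ.base m) I → M.IsMaximalHomogeneousIdeal m J →
          Ψ.stalkMap m '' I ⊆ J) ∧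
      -- smoothness of the base map
      ContMDiff 𝓘(ℝ, ZTwoN.Euc p) 𝓘(ℝ, ZTwoN.Euc p') ∞ Ψ.base := by
  refine ⟨fun U f m k => M.isValueAt_iff f m k, inferInstance,
    ZTwoN.Supermanifold.contMDiffOn_iff_eps, fun m => ?_, fun m I hI => ?_, fun Ψ =>
    ⟨fun V t => funext fun m => Ψ.eps_pull t m, fun V => ?_, fun m I J hI hJ => ?_,
      Ψ.contMDiff_base⟩⟩
  · exact ⟨_, M.isMaximalHomogeneousIdeal_iff.2 rfl,
      fun I hI => M.isMaximalHomogeneousIdeal_iff.1 hI⟩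
  · obtain rfl := M.isMaximalHomogeneousIdeal_iff.1 hI
    ext s
    constructor
    · intro hs
      obtain ⟨U, hm, f, rfl⟩ := M.exists_germ s
      exact ⟨U, hm, f, rfl, hs⟩
    · rintro ⟨U, hm, f, rfl, hf⟩
      exact hf
  · rintro _ ⟨t, ht, rfl⟩
    have ht' : N.eps t = 0 := ht
    refine funext fun m => ?_
    rw [Ψ.eps_pull, ht']
    rfl
  · obtain rfl := M.isMaximalHomogeneousIdeal_iff.1 hJ
    obtain rfl := N.isMaximalHomogeneousIdeal_iff.1 hI
    rintro _ ⟨s, hs, rfl⟩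
    change M.stalkEval m (Ψ.stalkMap m s) = 0
    rw [Ψ.stalkEval_stalkMap]
    exact hs
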